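/- Let $(\Omega,\preceq)$ be a linearly ordered set with the order topology, and let $E=\{(u,v)\in\Omega\times\Omega : u\preceq v\}$ carry the subspace topology of the product topology. A function $\ell:E\to[0,\infty)$ is a superadditive length function if it is continuous, $\ell(u,u)=0$ for all $u$, and $\ell(u,w)\ge \ell(u,v)+\ell(v,w)$ whenever $u\preceq v\preceq w$. A family $\{A(u,v)\}_{(u,v)\in E}$ of bounded operators on a complex Banach space is additive if $A(u,w)=A(u,v)+A(v,w)$ whenever $u\preceq v\preceq w$, and has geometric growth if there is a superadditive length function $\ell$ with $\|A(u,v)\|\le\ell(u,v)$ for all $(u,v)\in E$. A family $\{U(u,v)\}_{(u,v)\in E}$ is divisible if $U(u,u)=\mathrm{id}$ for all $u$ and $U(u,w)=U(u,v)U(v,w)$ whenever $u\preceq v\preceq w$, and it is strongly continuous if $(u,v)\mapsto U(u,v)y$ is norm-continuous on $E$ for every vector $y$. A bounded operator $A$ on a complex Banach space $X$ is dissipative if $\operatorname{Re}\,J(\xi)(A\xi)\le 0$ for all $\xi\in X$, for some (equivalently, every) map $J:X\to X'$ into the dual space with $\|J(\xi)\|=\|\xi\|$ and $J(\xi)(\xi)=\|\xi\|^2$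 for all $\xi\in X$. **Theorem (Continuous dilations of indivisible systems).** Let $\{A(u,v)\}_{(u,v)\in E}$ be a norm-continuous additive family of (not necessarily commuting) bounded operators on a complex Banach space $X$ with geometric growth, and let $\varphi(u,v)=e^{A(u,v)}$ for $(u,v)\in E$. (a) If each $A(u,v)$ is dissipative, then there exist a complex Banach space $\tilde X$, a strongly continuous divisible family $\{U(u,v)\}_{(u,v)\in E}$ of surjective linear isometries of $\tilde X$, a surjective linear contraction $j:\tilde X\to X$ and a linear isometry $r:X\to\tilde X$ with $j\circ r=\mathrm{id}_X$, such that $j\,U(u,v)\,r=\varphi(u,v)$ for all $(u,v)\in E$. (b) Suppose that $X=\mathcal A$ is a unital C*-algebra and that each $L=A(u,v)$ maps self-adjoint elements to self-adjoint elements and satisfies $L(1)=0$ and $D_L(a,a):=L(a^*a)-\bigl(L(a)^*a+a^*L(a)\bigr)\ge 0$ for all $a\in\mathcal A$. Then there exist a unital C*-algebra $\tilde{\mathcal A}$, which is commutative if $\mathcal A$ is, a strongly continuous divisible family $\{U(u,v)\}_{(u,v)\in E}$ of $*$-automorphisms of $\tilde{\mathcal A}$, a surjective unital $*$-homomorphism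 $j:\tilde{\mathcal A}\to\mathcal A$ and an isometric positive unital linear map $r:\mathcal A\to\tilde{\mathcal A}$ with $j\circ r=\mathrm{id}_{\mathcal A}$, such that $j\,U(u,v)\,r=\varphi(u,v)$ for all $(u,v)\in E$. -/

import Mathlib

open scoped NNReal

universe u v

namespace GraphDilation

section Graphs

/-- A graph on the node set `Ω` is given by its set of edges `E ⊆ Ω × Ω`; families on the graph are
functions on (the subtype of) `E`, which carries the subspace topology of `Ω × Ω`.
This is the graph whose edges are the pairs `(x, y)` with `x ≤ y`. -/
def orderEdges (Ω : Type u) [LE Ω] : Set (Ω × Ω) := {p | p.1 ≤ p.2}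

variable {Ω : Type u} {E : Set (Ω × Ω)}

/-- Identity axiom and divisibility axiom: a divisible dynamical system on the graph `(Ω, E)`. -/
def IsDivisibleSystem {M : Type v} [Monoid M] (φ : E → M) : Prop :=
  (∀ (x : Ω) (hxx : (x, x) ∈ E), φ ⟨(x, x), hxx⟩ = 1) ∧
  ∀ (x y z : Ω) (hxy : (x, y) ∈ E) (hyz : (y, z) ∈ E) (hxz : (x, z) ∈ E),
    φ ⟨(x, z), hxz⟩ = φ ⟨(x, y), hxy⟩ * φ ⟨(y, z), hyz⟩

/-- Additivity axiom for a family of generators on the graph `(Ω, E)`. -/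
def IsAdditiveFamily {M : Type v} [Add M] (A : E → M) : Prop :=
  ∀ (x y z : Ω) (hxy : (x, y) ∈ E) (hyz : (y, z) ∈ E) (hxz : (x, z) ∈ E),
    A ⟨(x, z), hxz⟩ = A ⟨(x, y), hxy⟩ + A ⟨(y, z), hyz⟩

/-- Superadditive length functions on the edges of the graph `(Ω, E)`. -/
structure IsSuperadditiveLength [TopologicalSpace Ω] (ℓ : E → ℝ≥0) : Prop where
  continuous : Continuous ℓ
  self_eq_zero : ∀ (x : Ω) (hxx : (x, x) ∈ E), ℓ ⟨(x, x), hxx⟩ = 0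
  superadditive : ∀ (x y z : Ω) (hxy : (x, y) ∈ E) (hyz : (y, z) ∈ E) (hxz : (x, z) ∈ E),
    ℓ ⟨(x, y), hxy⟩ + ℓ ⟨(y, z), hyz⟩ ≤ ℓ ⟨(x, z), hxz⟩

/-- Geometric growth of a family of bounded generators: the norms are dominated by some
superadditive length function. -/
def HasGeometricGrowth [TopologicalSpace Ω] {V : Type v} [Norm V] (A : E → V) : Prop :=
  ∃ ℓ : E → ℝ≥0, IsSuperadditiveLength ℓ ∧ ∀ e : E, ‖A e‖ ≤ (ℓ e : ℝ)

end Graphs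

section Dissipative

variable {X : Type v} [NormedAddCommGroup X] [NormedSpace ℂ X]

/-- A duality section: a norm-preserving, not necessarily linear map `J : X → X'` with
`⟨ξ, J ξ⟩ = ‖ξ‖²`. -/
def IsDualitySection (J : X → StrongDual ℂ X) : Prop :=
  ∀ ξ : X, ‖J ξ‖ = ‖ξ‖ ∧ J ξ ξ = ((‖ξ‖ ^ 2 : ℝ) : ℂ)

/-- A bounded operator is dissipative if it is so with respect to some duality section. -/
def IsDissipative (A : X →L[ℂ] X) : Prop :=
  ∃ J : X → StrongDual ℂ X, IsDualitySection J ∧ ∀ ξ : X, (J ξ (A ξ)).re ≤ 0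

end Dissipative

section CStar

variable {𝔄 : Type v} [CStarAlgebra 𝔄]

/-- Self-adjoint maps on a C*-algebra: self-adjoint elements are sent to self-adjoint elements. -/
def IsSelfAdjointMap (L : 𝔄 →L[ℂ] 𝔄) : Prop :=
  ∀ a : 𝔄, IsSelfAdjoint a → IsSelfAdjoint (L a)

/-- The dissipation map `D_L(a, b) = L(b* a) - (L(b)* a + b* L(a))`. -/
noncomputable def dissipationMap (L : 𝔄 →L[ℂ] 𝔄) (a b : 𝔄) : 𝔄 :=
  L (star b * a) - (star (L b) * a + star b * L a)

end CStar

section Dilations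

variable {Ω : Type u} [TopologicalSpace Ω] {E : Set (Ω × Ω)}

/-- The family `φ` on the graph `(Ω, E)` has a strongly continuous divisible dilation `(Y, U, j, r)`
to surjective linear isometries of a Banach space. -/
def HasBanachDilation {X : Type v} [NormedAddCommGroup X] [NormedSpace ℂ X]
    (φ : E → X →L[ℂ] X) : Prop :=
  ∃ (Y : Type (max u v)) (_ : NormedAddCommGroup Y) (_ : NormedSpace ℂ Y) (_ : CompleteSpace Y)
    (U : E → (Y ≃ₗᵢ[ℂ] Y)) (j : Y →L[ℂ] X) (r : X →ₗᵢ[ℂ] Y),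
    IsDivisibleSystem U ∧
    (∀ y : Y, Continuous fun e : E => U e y) ∧
    Function.Surjective j ∧ ‖j‖ ≤ 1 ∧
    (∀ x : X, j (r x) = x) ∧
    ∀ (e : E) (x : X), j (U e (r x)) = φ e x

/-- The family `φ` on the graph `(Ω, E)` of operators on a unital C*-algebra `𝔄` has a strongly
continuous divisible dilation `(𝔅, U, j, r)` to *-automorphisms of a unital C*-algebra `𝔅`, which is
commutative if `𝔄` is. -/
def HasCStarDilation {𝔄 : Type v} [CStarAlgebra 𝔄] [PartialOrder 𝔄] [StarOrderedRing 𝔄]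
    (φ : E → 𝔄 →L[ℂ] 𝔄) : Prop :=
  ∃ (𝔅 : Type (max u v)) (_ : CStarAlgebra 𝔅) (_ : PartialOrder 𝔅) (_ : StarOrderedRing 𝔅)
    (U : E → (𝔅 ≃⋆ₐ[ℂ] 𝔅)) (j : 𝔅 →⋆ₐ[ℂ] 𝔄) (r : 𝔄 →ₚ[ℂ] 𝔅),
    ((∀ a b : 𝔄, a * b = b * a) → ∀ a b : 𝔅, a * b = b * a) ∧
    IsDivisibleSystem U ∧
    (∀ b : 𝔅, Continuous fun e : E => U e b) ∧
    Function.Surjective j ∧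
    (∀ a : 𝔄, ‖r a‖ = ‖a‖) ∧ r 1 = 1 ∧
    (∀ a : 𝔄, j (r a) = a) ∧
    ∀ (e : E) (a : 𝔄), j (U e (r a)) = φ e a

end Dilations

end GraphDilation

/-!
An additive family on a linear order is the family of increments `A(u, v) = a(v) - a(u)` of an
operator-valued function `a`, so it extends from intervals to integer step functions `g` by
`g ↦ ∫ g da`. Step functions form a commutative group `G`, in which `[u, w) = [u, v) + [v, w)`. If
`Φ : G → B(X)` consists of contractions with `Φ 0 = 1`, then translations of bounded functions
`G → X` are isometries forming a representation of `G`; evaluation at `0` and the embedding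
`x ↦ (g ↦ Φ g x)` compress them to `Φ`. Thus restricting the translations to intervals gives a
divisible dilation of `Φ` restricted to intervals, whether or not `Φ` is multiplicative
(`hasBanachDilation_of_extension`, `hasCStarDilation_of_extension`). With values in a C*-algebra
these translations are automorphisms.

What remains is to extend `[u, v) ↦ exp A(u, v)` to contractions on all of `G` with enough
continuity. The choice is `Φ g = exp (∫ g⁺ da)` with the positive part `g⁺`, since `∫ g⁺ da` is a sum
of values of the family `A`, and generators of contractions are stable under sums
(`stepGenerator_mem`, `IsContractionGenerator.add`). Moving an end point of an interval changes `g⁺`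
by at most one, between the old and the new end point, so superadditivity of the length bounds the
change of `∫ g⁺ da` uniformly in `g` (`norm_stepGenerator_add_sub_le`). As the exponential is
`1`-Lipschitz on generators of contractions (`IsContractionGenerator.norm_exp_sub_exp_le`), the
functions `g ↦ Φ g x` lie in the closed invariant subspace of bounded functions whose translates are
norm-continuous, and that subspace is the dilation space.

On a C*-algebra the dissipation condition implies `‖1 + t L‖ ≤ 1 + O(t²)` by a second-order estimate
(`isContractionGenerator_of_dissipationMap_nonneg`). Positivity of the embedding follows because it is
unital, self-adjoint and isometric.
-/

namespace GraphDilation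

/-! ### Generators of contractions -/

section ContractionGenerator

open Filter Topology

variable {X : Type v} [NormedAddCommGroup X] [NormedSpace ℂ X]

/-- A bounded operator `A` with `‖1 + t A‖ ≤ 1 + O(t²)` for `t ≥ 0`. This is dissipativity, phrased so
that stability under sums and positive multiples is evident. -/
def IsContractionGenerator (A : X →L[ℂ] X) : Prop :=
  ∃ C : ℝ, 0 ≤ C ∧ ∀ t : ℝ, 0 ≤ t → ‖1 + (t : ℂ) • A‖ ≤ 1 + C * t ^ 2

lemma IsContractionGenerator.zero : IsContractionGenerator (0 : X →L[ℂ] X) :=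
  ⟨0, le_rfl, fun t _ => by
    simpa [ContinuousLinearMap.one_def] using ContinuousLinearMap.norm_id_le⟩

lemma IsContractionGenerator.add {A B : X →L[ℂ] X} (hA : IsContractionGenerator A)
    (hB : IsContractionGenerator B) : IsContractionGenerator (A + B) := by
  obtain ⟨C, hC, hA⟩ := hA
  obtain ⟨D, hD, hB⟩ := hB
  refine ⟨2 * (C + D), by positivity, fun t ht => ?_⟩
  have h1 := hA (2 * t) (by positivity)
  have h2 := hB (2 * t) (by positivity)
  have h : 1 + (t : ℂ) • (A + B) = (1 / 2 : ℂ) • ((1 + ((2 * t : ℝ) : ℂ) • A) +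
      (1 + ((2 * t : ℝ) : ℂ) • B)) := by
    push_cast
    module
  rw [h, norm_smul]
  have h3 := norm_add_le (1 + ((2 * t : ℝ) : ℂ) • A) (1 + ((2 * t : ℝ) : ℂ) • B)
  have h4 : ‖(1 / 2 : ℂ)‖ = 1 / 2 := by norm_num
  rw [h4]
  linarith

lemma IsContractionGenerator.smul {A : X →L[ℂ] X} (hA : IsContractionGenerator A) {s : ℝ}
    (hs : 0 ≤ s) : IsContractionGenerator ((s : ℂ) • A) := by
  obtain ⟨C, hC, hA⟩ := hA
  refine ⟨C * s ^ 2, by positivity, fun t ht => ?_⟩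
  have := hA (t * s) (by positivity)
  rw [smul_smul, ← Complex.ofReal_mul]
  linarith

lemma IsDissipative.isContractionGenerator {A : X →L[ℂ] X} (hA : IsDissipative A) :
    IsContractionGenerator A := by
  obtain ⟨J, hJ, hA⟩ := hA
  -- `ξ - t A ξ` is at least as long as `ξ`, by testing against the functional `J ξ`.
  have key : ∀ (t : ℝ), 0 ≤ t → ∀ ξ : X, ‖ξ‖ ≤ ‖ξ - (t : ℂ) • A ξ‖ := by
    intro t ht ξ
    rcases eq_or_ne ξ 0 with rfl | hξ
    · simp
    have hpos : 0 < ‖ξ‖ := norm_pos_iff.2 hξ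
    have h1 : ‖ξ‖ ^ 2 ≤ (J ξ (ξ - (t : ℂ) • A ξ)).re := by
      rw [map_sub, map_smul, (hJ ξ).2, smul_eq_mul, Complex.sub_re, Complex.re_ofReal_mul,
        Complex.ofReal_re]
      nlinarith [hA ξ]
    have h2 := (Complex.re_le_norm _).trans ((J ξ).le_opNorm (ξ - (t : ℂ) • A ξ))
    rw [(hJ ξ).1] at h2
    nlinarith
  refine ⟨‖A‖ ^ 2, by positivity, fun t ht => ?_⟩
  refine ContinuousLinearMap.opNorm_le_bound _ (by positivity) fun ξ => ?_
  -- `(1 - t A)(1 + t A) = 1 - t² A²`.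
  have h := key t ht ((1 + (t : ℂ) • A) ξ)
  have e : (1 + (t : ℂ) • A) ξ - (t : ℂ) • A ((1 + (t : ℂ) • A) ξ) =
      ξ - ((t : ℂ) * t) • A (A ξ) := by
    simp only [add_apply, one_apply_eq_self, smul_apply, map_add, map_smul]
    module
  rw [e] at h
  refine h.trans ((norm_sub_le _ _).trans ?_)
  have h3 : ‖A (A ξ)‖ ≤ ‖A‖ * (‖A‖ * ‖ξ‖) := A.le_opNorm_of_le (A.le_opNorm ξ)
  rw [norm_smul, ← Complex.ofReal_mul, Complex.norm_of_nonneg (by positivity)]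
  nlinarith [mul_le_mul_of_nonneg_left h3 (mul_nonneg ht ht)]

variable [CompleteSpace X]

lemma exp_eq_exp_inv_smul_pow (A : X →L[ℂ] X) {n : ℕ} (hn : n ≠ 0) :
    NormedSpace.exp A = NormedSpace.exp (((n : ℝ)⁻¹ : ℂ) • A) ^ n := by
  let _ : NormedAlgebra ℚ (X →L[ℂ] X) := NormedAlgebra.restrictScalars ℚ ℂ _
  rw [← NormedSpace.exp_nsmul, ← Nat.cast_smul_eq_nsmul ℂ, smul_smul]
  have : (n : ℂ) ≠ 0 := by exact_mod_cast hn
  simp [this]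

lemma tendsto_smul_exp_inv_smul_sub_one (A : X →L[ℂ] X) :
    Tendsto (fun n : ℕ => (n : ℂ) • (NormedSpace.exp (((n : ℝ)⁻¹ : ℂ) • A) - 1)) atTop (𝓝 A) := by
  have h : HasDerivAt (fun z : ℂ => NormedSpace.exp (z • A)) A 0 := by
    simpa using hasDerivAt_exp_smul_const (𝕂 := ℂ) A (0 : ℂ)
  have h2 := h.tendsto_slope_zero
  have h3 : Tendsto (fun n : ℕ => ((n : ℝ)⁻¹ : ℂ)) atTop (𝓝[≠] 0) := by
    refine tendsto_nhdsWithin_iff.2 ⟨?_, ?_⟩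
    · simpa using tendsto_inv_atTop_nhds_zero_nat (𝕜 := ℂ)
    · filter_upwards [eventually_ne_atTop 0] with n hn
      simpa using hn
  refine (h2.comp h3).congr fun n => ?_
  simp

/-- A generator of contractions exponentiates to a contraction: `e^A = (e^{A/n})^n`, and
`‖e^{A/n}‖ ≤ 1 + o(1/n)`. -/
lemma IsContractionGenerator.norm_exp_le_one {A : X →L[ℂ] X} (hA : IsContractionGenerator A) :
    ‖NormedSpace.exp A‖ ≤ 1 := by
  obtain ⟨C, hC, hA⟩ := hA
  set E : ℕ → X →L[ℂ] X := fun n => NormedSpace.exp (((n : ℝ)⁻¹ : ℂ) • A)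
  set δ : ℕ → ℝ := fun n => C * (n : ℝ)⁻¹ + ‖(n : ℂ) • (E n - 1) - A‖
  have hδ : Tendsto δ atTop (𝓝 0) := by
    have h1 : Tendsto (fun n : ℕ => C * (n : ℝ)⁻¹) atTop (𝓝 (C * 0)) :=
      (tendsto_inv_atTop_nhds_zero_nat (𝕜 := ℝ)).const_mul C
    have h2 : Tendsto (fun n : ℕ => ‖(n : ℂ) • (E n - 1) - A‖) atTop (𝓝 ‖A - A‖) :=
      ((tendsto_smul_exp_inv_smul_sub_one A).sub_const A).norm
    simpa using h1.add h2
  have hlim : Tendsto (fun n => Real.exp (δ n)) atTop (𝓝 1) := by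
    simpa [Function.comp_def] using (Real.continuous_exp.tendsto 0).comp hδ
  refine ge_of_tendsto hlim ?_
  filter_upwards [eventually_gt_atTop 0] with n hn
  have hn' : (0 : ℝ) < n := by exact_mod_cast hn
  have hn0 : (n : ℂ) ≠ 0 := by exact_mod_cast hn.ne'
  have hE : ‖E n‖ ≤ 1 + δ n * (n : ℝ)⁻¹ := by
    have e : E n = (1 + (((n : ℝ)⁻¹ : ℝ) : ℂ) • A) + (((n : ℝ)⁻¹ : ℝ) : ℂ) •
        ((n : ℂ) • (E n - 1) - A) := by
      rw [smul_sub, smul_smul]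
      simp [hn0]
    rw [e]
    refine (norm_add_le _ _).trans ?_
    rw [norm_smul, Complex.norm_of_nonneg (by positivity)]
    have := hA ((n : ℝ)⁻¹) (by positivity)
    simp only [δ]
    linarith
  rw [exp_eq_exp_inv_smul_pow A hn.ne']
  calc ‖E n ^ n‖ ≤ ‖E n‖ ^ n := norm_pow_le' _ hn
    _ ≤ (Real.exp (δ n * (n : ℝ)⁻¹)) ^ n := by
      refine pow_le_pow_left₀ (norm_nonneg _) (hE.trans ?_) n
      linarith [Real.add_one_le_exp (δ n * (n : ℝ)⁻¹)]
    _ = Real.exp (δ n) := by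
      rw [← Real.exp_nat_mul]
      congr 1
      field_simp

lemma norm_pow_sub_pow_le_of_norm_le_one {R : Type*} [SeminormedRing R] {x y : R} (hx : ‖x‖ ≤ 1)
    (hy : ‖y‖ ≤ 1) (n : ℕ) : ‖x ^ n - y ^ n‖ ≤ n * ‖x - y‖ := by
  induction n with
  | zero => simp
  | succ n ih =>
    rcases Nat.eq_zero_or_pos n with rfl | hn
    · simp
    have e : x ^ (n + 1) - y ^ (n + 1) = x ^ n * (x - y) + (x ^ n - y ^ n) * y := by
      rw [pow_succ, pow_succ]
      noncomm_ring
    have h1 : ‖x ^ n‖ ≤ 1 := (norm_pow_le' _ hn).trans (pow_le_one₀ (norm_nonneg _) hx)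
    rw [e]
    calc _ ≤ ‖x ^ n‖ * ‖x - y‖ + ‖x ^ n - y ^ n‖ * ‖y‖ :=
          (norm_add_le _ _).trans (add_le_add (norm_mul_le _ _) (norm_mul_le _ _))
      _ ≤ 1 * ‖x - y‖ + ‖x ^ n - y ^ n‖ * 1 := by gcongr
      _ ≤ _ := by push_cast; linarith

/-- On generators of contractions the exponential is `1`-Lipschitz, although their norms are
unbounded. This makes the dilation strongly continuous. -/
lemma IsContractionGenerator.norm_exp_sub_exp_le {A B : X →L[ℂ] X}
    (hA : IsContractionGenerator A) (hB : IsContractionGenerator B) :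
    ‖NormedSpace.exp A - NormedSpace.exp B‖ ≤ ‖A - B‖ := by
  have hlim := ((tendsto_smul_exp_inv_smul_sub_one A).sub
    (tendsto_smul_exp_inv_smul_sub_one B)).norm
  refine ge_of_tendsto hlim ?_
  filter_upwards [eventually_gt_atTop 0] with n hn
  have hn' : (0 : ℝ) ≤ (n : ℝ)⁻¹ := by positivity
  have hA' := (hA.smul hn').norm_exp_le_one
  have hB' := (hB.smul hn').norm_exp_le_one
  push_cast at hA' hB'
  rw [exp_eq_exp_inv_smul_pow A hn.ne', exp_eq_exp_inv_smul_pow B hn.ne', ← smul_sub, norm_smul,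
    sub_sub_sub_cancel_right, Complex.norm_natCast]
  push_cast
  exact norm_pow_sub_pow_le_of_norm_le_one hA' hB' n

end ContractionGenerator

/-! ### Dissipations of C*-algebras generate contractions -/

section Dissipation

variable {𝔄 : Type v} [CStarAlgebra 𝔄]

lemma IsSelfAdjointMap.map_star {L : 𝔄 →L[ℂ] 𝔄} (hL : IsSelfAdjointMap L) (a : 𝔄) :
    L (star a) = star (L a) := by
  have h1 := (hL _ (realPart a).2).star_eq
  have h2 := (hL _ (imaginaryPart a).2).star_eq
  have e : a = (realPart a : 𝔄) + Complex.I • (imaginaryPart a : 𝔄) :=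
    (realPart_add_I_smul_imaginaryPart a).symm
  have e' : star a = (realPart a : 𝔄) - Complex.I • (imaginaryPart a : 𝔄) := by
    conv_lhs => rw [e]
    rw [star_add, star_smul, (realPart a).2.star_eq, (imaginaryPart a).2.star_eq]
    simp [sub_eq_add_neg]
  rw [e']
  conv_rhs => rw [e]
  rw [map_sub, map_add, map_smul, star_add, star_smul, h1, h2]
  simp [sub_eq_add_neg]

variable [PartialOrder 𝔄] [StarOrderedRing 𝔄]

lemma nonneg_of_norm_sub_le {x : 𝔄} (hx : IsSelfAdjoint x) {M : ℝ}
    (h : ‖algebraMap ℝ 𝔄 M - x‖ ≤ M) : 0 ≤ x := by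
  have h0 : IsSelfAdjoint (algebraMap ℝ 𝔄 M - x) := (IsSelfAdjoint.algebraMap 𝔄 (.all M)).sub hx
  have h1 := h0.le_algebraMap_norm_self.trans (algebraMap_mono 𝔄 h)
  simpa using h1

lemma norm_algebraMap_sub_le {x : 𝔄} (hx : 0 ≤ x) : ‖algebraMap ℝ 𝔄 ‖x‖ - x‖ ≤ ‖x‖ := by
  have h1 : x ≤ algebraMap ℝ 𝔄 ‖x‖ := (IsSelfAdjoint.of_nonneg hx).le_algebraMap_norm_self
  exact (CStarAlgebra.norm_le_iff_le_algebraMap _ (norm_nonneg x) (sub_nonneg.2 h1)).2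
    (sub_le_self _ hx)

variable {L : 𝔄 →L[ℂ] 𝔄}

/-- A dissipation moves the upper bound of a positive element only to second order. With
`d = (‖b‖ - b)^{1/2}`, dissipativity at `d` gives `(d + t L d)² ≤ ‖b‖ - b - t L b + t² (L d)²`. -/
lemma add_smul_le_of_dissipationMap_nonneg (hL : IsSelfAdjointMap L) (h1 : L 1 = 0)
    (hD : ∀ a, 0 ≤ dissipationMap L a a) {b : 𝔄} (hb : 0 ≤ b) {t : ℝ} (ht : 0 ≤ t) :
    b + t • L b ≤ algebraMap ℝ 𝔄 (‖b‖ * (1 + t ^ 2 * ‖L‖ ^ 2)) := by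
  set c : 𝔄 := algebraMap ℝ 𝔄 ‖b‖ - b with hc
  have hc0 : 0 ≤ c := sub_nonneg.2 (IsSelfAdjoint.of_nonneg hb).le_algebraMap_norm_self
  set d := CFC.sqrt c
  have hd : star d = d := (IsSelfAdjoint.of_nonneg (CFC.sqrt_nonneg c)).star_eq
  have hdd : d * d = c := CFC.sqrt_mul_sqrt_self c hc0
  have hLd : star (L d) = L d := (hL d hd).star_eq
  have hdn : ‖d‖ ^ 2 ≤ ‖b‖ := by
    have : ‖d‖ * ‖d‖ = ‖c‖ := by rw [← CStarRing.norm_star_mul_self, hd, hdd]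
    rw [sq, this]
    exact norm_algebraMap_sub_le hb
  have hLc : L c = - L b := by
    have : (algebraMap ℝ 𝔄 ‖b‖) = ((‖b‖ : ℝ) : ℂ) • (1 : 𝔄) := by
      rw [Algebra.algebraMap_eq_smul_one, Complex.coe_smul]
    rw [hc, map_sub, this, map_smul, h1, smul_zero, zero_sub]
  have h2 : 0 ≤ - L b - (L d * d + d * L d) := by
    have := hD d
    rwa [dissipationMap, hd, hdd, hLd, hLc] at this
  have h3 : 0 ≤ (d + t • L d) * (d + t • L d) := by
    have := star_mul_self_nonneg (d + t • L d)
    rwa [star_add, star_smul, hd, hLd, star_trivial] at this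
  have h4 : L d * L d ≤ algebraMap ℝ 𝔄 (‖L‖ ^ 2 * ‖b‖) := by
    have h := CStarAlgebra.star_mul_le_algebraMap_norm_sq (a := L d)
    rw [hLd] at h
    refine h.trans (algebraMap_mono 𝔄 ?_)
    calc ‖L d‖ ^ 2 ≤ (‖L‖ * ‖d‖) ^ 2 := by gcongr; exact L.le_opNorm d
      _ = ‖L‖ ^ 2 * ‖d‖ ^ 2 := by ring
      _ ≤ _ := by gcongr
  have h5 := add_nonneg (add_nonneg (smul_nonneg ht h2) h3)
    (smul_nonneg (sq_nonneg t) (sub_nonneg.2 h4))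
  rw [← sub_nonneg]
  convert h5 using 1
  have e : (d + t • L d) * (d + t • L d) =
      (algebraMap ℝ 𝔄 ‖b‖ - b) + t • (L d * d + d * L d) + t ^ 2 • (L d * L d) := by
    rw [← hc, ← hdd]
    simp only [add_mul, mul_add, smul_mul_assoc, mul_smul_comm, smul_smul, smul_add, sq]
    abel
  rw [e]
  simp only [Algebra.algebraMap_eq_smul_one]
  module

lemma isContractionGenerator_of_dissipationMap_nonneg (hL : IsSelfAdjointMap L) (h1 : L 1 = 0)
    (hD : ∀ a, 0 ≤ dissipationMap L a a) : IsContractionGenerator L := by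
  refine ⟨‖L‖ ^ 2, by positivity, fun t ht => ?_⟩
  refine ContinuousLinearMap.opNorm_le_bound _ (by positivity) fun a => ?_
  have e0 : (1 + (t : ℂ) • L) a = a + t • L a := by
    simp [Complex.coe_smul]
  rw [e0]
  set b := star a * a with hb
  have hbn : ‖b‖ = ‖a‖ ^ 2 := by rw [hb, CStarRing.norm_star_mul_self, sq]
  have h2 := add_smul_le_of_dissipationMap_nonneg hL h1 hD (star_mul_self_nonneg a) ht
  rw [← hb, hbn] at h2
  have h3 : 0 ≤ L b - (star (L a) * a + star a * L a) := hD a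
  have h4 : star (L a) * L a ≤ algebraMap ℝ 𝔄 (‖L‖ ^ 2 * ‖a‖ ^ 2) := by
    refine CStarAlgebra.star_mul_le_algebraMap_norm_sq.trans (algebraMap_mono 𝔄 ?_)
    rw [← mul_pow]
    gcongr
    exact L.le_opNorm a
  have e : star (a + t • L a) * (a + t • L a) =
      b + t • (star (L a) * a + star a * L a) + t ^ 2 • (star (L a) * L a) := by
    rw [hb]
    simp only [star_add, star_smul, star_trivial, add_mul, mul_add, smul_mul_assoc,
      mul_smul_comm, smul_smul, smul_add, sq]
    abel
  have h5 : star (a + t • L a) * (a + t • L a) ≤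
      algebraMap ℝ 𝔄 (‖a‖ ^ 2 * (1 + 2 * (t ^ 2 * ‖L‖ ^ 2))) := by
    rw [e, ← sub_nonneg]
    convert add_nonneg (add_nonneg (sub_nonneg.2 h2) (smul_nonneg ht h3))
      (smul_nonneg (sq_nonneg t) (sub_nonneg.2 h4)) using 1
    simp only [Algebra.algebraMap_eq_smul_one]
    module
  have h6 := (CStarAlgebra.norm_le_iff_le_algebraMap _ (by positivity)
    (star_mul_self_nonneg _)).2 h5
  rw [CStarRing.norm_star_mul_self] at h6
  refine abs_le_of_sq_le_sq' ?_ (by positivity) |>.2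
  nlinarith [mul_nonneg (sq_nonneg ‖a‖) (sq_nonneg (t ^ 2 * ‖L‖ ^ 2))]

end Dissipation

/-! ### Summation by parts against step functions -/

section StepFunction

variable {Ω : Type u}

open Classical in
/-- The mass of a set under a finitely supported integer measure. The element `g` stands for the step
function `t ↦ mass (Set.Ioi t) g`; the interval `[u, v)` is `single v 1 - single u 1`. -/
noncomputable def mass (s : Set Ω) : (Ω →₀ ℤ) →+ ℤ :=
  Finsupp.liftAddHom fun t => if t ∈ s then AddMonoidHom.id ℤ else 0

open Classical in
lemma mass_single (s : Set Ω) (t : Ω) (n : ℤ) :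
    mass s (Finsupp.single t n) = if t ∈ s then n else 0 := by
  rw [mass, Finsupp.liftAddHom_apply_single]
  split_ifs <;> rfl

lemma mass_eq_sum {s : Set Ω} {g : Ω →₀ ℤ} {S : Finset Ω}
    (hS : ∀ t, g t ≠ 0 → (t ∈ S ↔ t ∈ s)) (hS' : ∀ t ∈ S, t ∈ s) :
    mass s g = ∑ t ∈ S, g t := by
  classical
  have h : mass s g = ∑ t ∈ g.support, if t ∈ s then g t else 0 := by
    rw [mass, Finsupp.liftAddHom_apply, Finsupp.sum]
    refine Finset.sum_congr rfl fun t _ => ?_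
    split_ifs <;> rfl
  rw [h, ← Finset.sum_filter]
  refine Finset.sum_subset_zero_on_sdiff ?_ ?_ fun _ _ => rfl
  · intro t ht
    rw [Finset.mem_filter, Finsupp.mem_support_iff] at ht
    exact (hS t ht.1).2 ht.2
  · intro t ht
    rw [Finset.mem_sdiff, Finset.mem_filter, Finsupp.mem_support_iff] at ht
    by_contra h0
    exact ht.2 ⟨h0, hS' t ht.1⟩

lemma mass_univ (g : Ω →₀ ℤ) : mass Set.univ g = ∑ t ∈ g.support, g t :=
  mass_eq_sum (by simp) (by simp)

lemma mass_congr {s s' : Set Ω} {g : Ω →₀ ℤ} (h : ∀ t, g t ≠ 0 → (t ∈ s ↔ t ∈ s')) :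
    mass s g = mass s' g := by
  classical
  rw [mass_eq_sum (S := g.support.filter (· ∈ s)) (by simp +contextual) (by simp),
    mass_eq_sum (s := s') (S := g.support.filter (· ∈ s))]
  · intro t ht
    simp [ht, h t ht]
  · intro t ht
    rw [Finset.mem_filter, Finsupp.mem_support_iff] at ht
    exact (h t ht.1).1 ht.2

/-- The sum `∑ g(t) a(t)`, which is the integral of the step function of `g` against `da` when `g`
has total mass zero. -/
noncomputable def pairing {V : Type*} [AddCommGroup V] (a : Ω → V) : (Ω →₀ ℤ) →+ V :=
  Finsupp.liftAddHom fun t => zmultiplesHom V (a t)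

lemma pairing_single {V : Type*} [AddCommGroup V] (a : Ω → V) (t : Ω) (n : ℤ) :
    pairing a (Finsupp.single t n) = n • a t := by
  rw [pairing, Finsupp.liftAddHom_apply_single, zmultiplesHom_apply]

lemma pairing_eq_sum {V : Type*} [AddCommGroup V] (a : Ω → V) (g : Ω →₀ ℤ) :
    pairing a g = ∑ t ∈ g.support, g t • a t := by
  rw [pairing, Finsupp.liftAddHom_apply, Finsupp.sum]
  simp only [zmultiplesHom_apply]

variable [LinearOrder Ω]

lemma mass_Ici_sub_mass_Ioi (g : Ω →₀ ℤ) (t : Ω) :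
    mass (Set.Ici t) g - mass (Set.Ioi t) g = g t := by
  induction g using Finsupp.induction_linear with
  | zero => simp
  | add f g hf hg => rw [map_add, map_add, Finsupp.add_apply, ← hf, ← hg]; ring
  | single s n =>
    rw [mass_single, mass_single, Finsupp.single_apply, Set.mem_Ici, Set.mem_Ioi]
    rcases lt_trichotomy t s with h | rfl | h
    · simp [h, h.le, h.ne']
    · simp
    · simp [h.not_ge, h.not_gt, h.ne]

/-- The positive part of the step function represented by `g`. -/
noncomputable def stepPosPart (g : Ω →₀ ℤ) : Ω →₀ ℤ :=
  Finsupp.onFinset g.support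
    (fun t => max (mass (Set.Ici t) g) 0 - max (mass (Set.Ioi t) g) 0) fun t ht => by
      rw [Finsupp.mem_support_iff]
      intro h
      rw [← mass_Ici_sub_mass_Ioi, sub_eq_zero] at h
      rw [h, sub_self] at ht
      exact ht rfl

lemma stepPosPart_apply (g : Ω →₀ ℤ) (t : Ω) :
    stepPosPart g t = max (mass (Set.Ici t) g) 0 - max (mass (Set.Ioi t) g) 0 := rfl

/-- Upper masses of the positive part, by telescoping. -/
lemma mass_stepPosPart (g : Ω →₀ ℤ) {U : Set Ω} (hU : IsUpperSet U) :
    mass U (stepPosPart g) = max (mass U g) 0 := by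
  classical
  have key : ∀ S : Finset Ω, ∀ U : Set Ω, IsUpperSet U → (∀ t, t ∈ S ↔ g t ≠ 0 ∧ t ∈ U) →
      ∑ t ∈ S, stepPosPart g t = max (mass U g) 0 := by
    intro S
    induction S using Finset.induction_on_min with
    | empty =>
      intro U _ h
      rw [mass_eq_sum (S := ∅) (fun t ht => by simpa [ht] using h t) (by simp)]
      simp
    | insert m S hm ih =>
      intro U hU h
      have hmS : m ∉ S := fun h => lt_irrefl _ (hm m h)
      have hmU := (h m).1 (Finset.mem_insert_self m S)
      have hS : ∀ t, t ∈ S ↔ g t ≠ 0 ∧ t ∈ Set.Ioi m := by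
        intro t
        refine ⟨fun ht => ⟨((h t).1 (Finset.mem_insert_of_mem ht)).1, hm t ht⟩, fun ht => ?_⟩
        exact Finset.mem_of_mem_insert_of_ne
          ((h t).2 ⟨ht.1, hU (le_of_lt ht.2) hmU.2⟩) (ne_of_gt ht.2)
      have hIci : mass U g = mass (Set.Ici m) g := by
        refine mass_congr fun t ht => ⟨fun htU => ?_, fun htm => hU htm hmU.2⟩
        rcases Finset.mem_insert.1 ((h t).2 ⟨ht, htU⟩) with rfl | h'
        · exact le_rfl
        · exact (hm t h').le
      rw [Finset.sum_insert hmS, ih _ (isUpperSet_Ioi m) hS, stepPosPart_apply, hIci]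
      ring
  rw [← key (g.support.filter (· ∈ U)) U hU (by simp)]
  refine mass_eq_sum (fun t ht => ?_) (by simp)
  have h0 : g t ≠ 0 := by
    rw [← Finsupp.mem_support_iff]
    exact Finsupp.support_onFinset_subset (Finsupp.mem_support_iff.2 ht)
  simp [h0]

lemma stepPosPart_eq_self {g : Ω →₀ ℤ} (h : ∀ U : Set Ω, IsUpperSet U → 0 ≤ mass U g) :
    stepPosPart g = g := by
  ext t
  rw [stepPosPart_apply, max_eq_left (h _ (isUpperSet_Ici t)), max_eq_left (h _ (isUpperSet_Ioi t)),
    mass_Ici_sub_mass_Ioi]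

/-- Raising the right end point of an interval changes the mass of an upper set by at most one. -/
lemma mass_single_sub_single {u u' : Ω} (h : u ≤ u') {U : Set Ω} (hU : IsUpperSet U) :
    0 ≤ mass U (Finsupp.single u' 1 - Finsupp.single u 1) ∧
      mass U (Finsupp.single u' 1 - Finsupp.single u 1) ≤ 1 := by
  rw [map_sub, mass_single, mass_single]
  by_cases h1 : u ∈ U
  · simp [h1, hU h h1]
  · by_cases h2 : u' ∈ U <;> simp [h1, h2]

lemma stepPosPart_single_sub_single {u u' : Ω} (h : u ≤ u') :
    stepPosPart (Finsupp.single u' 1 - Finsupp.single u 1) =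
      Finsupp.single u' 1 - Finsupp.single u 1 :=
  stepPosPart_eq_self fun _ hU => (mass_single_sub_single h hU).1

/-- Summation by parts: if all upper masses are nonnegative, the sum is a nonnegative combination
of increments of `a`. -/
lemma sum_smul_sub_mem {V : Type*} [AddCommGroup V] {C : AddSubmonoid V} {a : Ω → V}
    (ha : ∀ u v, u ≤ v → a v - a u ∈ C) {d : Ω → ℤ} (S : Finset Ω)
    (hd : ∀ T ⊆ S, (∀ x ∈ T, ∀ y ∈ S, x ≤ y → y ∈ T) → 0 ≤ ∑ t ∈ T, d t) (m' : Ω)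
    (hm' : ∀ x ∈ S, m' ≤ x) : ∑ t ∈ S, d t • a t - (∑ t ∈ S, d t) • a m' ∈ C := by
  classical
  induction S using Finset.induction_on_min generalizing m' with
  | empty => simp
  | insert m S hm ih =>
    have hmS : m ∉ S := fun h => lt_irrefl _ (hm m h)
    have h1 := ih (fun T hT hup => hd T (hT.trans (Finset.subset_insert _ _)) fun x hx y hy hxy => by
      rcases Finset.mem_insert.1 hy with rfl | hy
      · exact absurd hxy (hm x (hT hx)).not_ge
      · exact hup x hx y hy hxy) m fun x hx => (hm x hx).le
    obtain ⟨n, hn⟩ := Int.eq_ofNat_of_zero_le (hd _ subset_rfl fun _ _ _ hy _ => hy)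
    have h2 := C.add_mem h1 (C.nsmul_mem (ha m' m (hm' m (Finset.mem_insert_self _ _))) n)
    convert h2 using 1
    rw [hn, ← natCast_zsmul]
    rw [← hn, Finset.sum_insert hmS, Finset.sum_insert hmS]
    module

/-- Summation by parts: if all upper masses are at most one in absolute value, the sum is bounded
by the length of an interval containing the support. -/
lemma norm_sum_smul_sub_le {V : Type*} [SeminormedAddCommGroup V] {a : Ω → V} {ℓ : Ω → Ω → ℝ}
    (hpos : ∀ u v, 0 ≤ ℓ u v) (ha : ∀ u v, u ≤ v → ‖a v - a u‖ ≤ ℓ u v)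
    (hadd : ∀ u v w, u ≤ v → v ≤ w → ℓ u v + ℓ v w ≤ ℓ u w) {d : Ω → ℤ} (S : Finset Ω)
    (hd : ∀ T ⊆ S, (∀ x ∈ T, ∀ y ∈ S, x ≤ y → y ∈ T) → |∑ t ∈ T, d t| ≤ 1) {M : Ω}
    (hM : ∀ x ∈ S, x ≤ M) (m' : Ω) (hm' : ∀ x ∈ S, m' ≤ x) :
    ‖∑ t ∈ S, d t • a t - (∑ t ∈ S, d t) • a m'‖ ≤ ℓ m' M := by
  classical
  induction S using Finset.induction_on_min generalizing m' with
  | empty => simpa using hpos m' M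
  | insert m S hm ih =>
    have hmS : m ∉ S := fun h => lt_irrefl _ (hm m h)
    have h1 := ih (fun T hT hup => hd T (hT.trans (Finset.subset_insert _ _)) fun x hx y hy hxy => by
      rcases Finset.mem_insert.1 hy with rfl | hy
      · exact absurd hxy (hm x (hT hx)).not_ge
      · exact hup x hx y hy hxy) (fun x hx => hM x (Finset.mem_insert_of_mem hx)) m
      fun x hx => (hm x hx).le
    have h2 := hd _ subset_rfl fun _ _ _ hy _ => hy
    have hmm := hm' m (Finset.mem_insert_self _ _)
    set k := ∑ t ∈ insert m S, d t with hk
    have h3 : ‖k • (a m - a m')‖ ≤ ℓ m' m := by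
      refine (norm_zsmul_le _ _).trans ?_
      have h4 : ‖k‖ ≤ 1 := by rw [Int.norm_eq_abs]; exact_mod_cast h2
      calc _ ≤ 1 * ‖a m - a m'‖ := by gcongr
        _ ≤ _ := by rw [one_mul]; exact ha _ _ hmm
    have e : ∑ t ∈ insert m S, d t • a t - k • a m' =
        (∑ t ∈ S, d t • a t - (∑ t ∈ S, d t) • a m) + k • (a m - a m') := by
      rw [hk, Finset.sum_insert hmS, Finset.sum_insert hmS]
      module
    rw [e]
    have h5 := hadd m' m M hmm (hM m (Finset.mem_insert_self _ _))
    linarith [norm_add_le (∑ t ∈ S, d t • a t - (∑ t ∈ S, d t) • a m) (k • (a m - a m'))]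

/-- An upper subset of the support is cut out by an upper set. -/
lemma sum_eq_mass_upperClosure (g : Ω →₀ ℤ) {T : Finset Ω}
    (h : ∀ x ∈ T, ∀ y ∈ g.support, x ≤ y → y ∈ T) :
    ∑ t ∈ T, g t = mass (upperClosure (T : Set Ω)) g := by
  refine (mass_eq_sum (fun t ht => ⟨fun htT => subset_upperClosure htT, ?_⟩)
    fun t htT => subset_upperClosure htT).symm
  rintro ⟨x, hx, hxt⟩
  exact h x hx t (Finsupp.mem_support_iff.2 ht) hxt

variable {V : Type*}

/-- The generator attached to a group element: the integral of the positive part of its step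
function. Elements of nonzero total mass do not represent step functions of bounded support and get
the value zero. -/
noncomputable def stepGenerator [AddCommGroup V] (a : Ω → V) (g : Ω →₀ ℤ) : V :=
  if mass Set.univ g = 0 then pairing a (stepPosPart g) else 0

lemma stepGenerator_zero [AddCommGroup V] (a : Ω → V) : stepGenerator a 0 = 0 := by
  have : stepPosPart (0 : Ω →₀ ℤ) = 0 := stepPosPart_eq_self fun U _ => by simp
  simp [stepGenerator, this]

lemma stepGenerator_single_sub_single [AddCommGroup V] (a : Ω → V) {u v : Ω} (h : u ≤ v) :
    stepGenerator a (Finsupp.single v 1 - Finsupp.single u 1) = a v - a u := by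
  rw [stepGenerator, if_pos, stepPosPart_single_sub_single h, map_sub, pairing_single,
    pairing_single, one_zsmul, one_zsmul]
  simp [mass_single]

lemma stepGenerator_mem [AddCommGroup V] {C : AddSubmonoid V} {a : Ω → V}
    (ha : ∀ u v, u ≤ v → a v - a u ∈ C) (g : Ω →₀ ℤ) : stepGenerator a g ∈ C := by
  rw [stepGenerator]
  split_ifs with hg
  · set d := stepPosPart g with hd
    rcases d.support.eq_empty_or_nonempty with h0 | hne
    · rw [Finsupp.support_eq_empty.1 h0, map_zero]
      exact C.zero_mem
    have h := sum_smul_sub_mem (C := C) ha d.support (d := d) (fun T _ hup => by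
      rw [sum_eq_mass_upperClosure d hup, hd, mass_stepPosPart g (UpperSet.upper _)]
      exact le_max_right _ _) (d.support.min' hne) fun x hx => Finset.min'_le _ _ hx
    have h2 : ∑ t ∈ d.support, d t = 0 := by
      rw [← mass_univ, hd, mass_stepPosPart g isUpperSet_univ, hg, max_self]
    rwa [h2, zero_smul, sub_zero, ← pairing_eq_sum] at h
  · exact C.zero_mem

/-- Moving an end point from `u` to `u'` changes the generator by at most the length of the interval
between them, uniformly in `g`. -/
lemma norm_stepGenerator_add_sub_le [SeminormedAddCommGroup V] {a : Ω → V} {ℓ : Ω → Ω → ℝ}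
    (hpos : ∀ u v, 0 ≤ ℓ u v) (ha : ∀ u v, u ≤ v → ‖a v - a u‖ ≤ ℓ u v)
    (hadd : ∀ u v w, u ≤ v → v ≤ w → ℓ u v + ℓ v w ≤ ℓ u w) (g : Ω →₀ ℤ) {u u' : Ω}
    (h : u ≤ u') :
    ‖stepGenerator a (g + (Finsupp.single u' 1 - Finsupp.single u 1)) - stepGenerator a g‖ ≤
      ℓ u u' := by
  set e : Ω →₀ ℤ := Finsupp.single u' 1 - Finsupp.single u 1 with he
  have h0 : mass Set.univ e = 0 := by simp [he, mass_single]
  rw [stepGenerator, stepGenerator, map_add, h0, add_zero]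
  split_ifs with hg
  · rw [← map_sub]
    set d := stepPosPart (g + e) - stepPosPart g with hd
    have hmass : ∀ U : Set Ω, IsUpperSet U →
        mass U d = max (mass U g + mass U e) 0 - max (mass U g) 0 := fun U hU => by
      rw [hd, map_sub, mass_stepPosPart _ hU, mass_stepPosPart _ hU, map_add]
    have habs : ∀ U : Set Ω, IsUpperSet U → |mass U d| ≤ 1 := fun U hU => by
      obtain ⟨h1, h2⟩ := mass_single_sub_single h hU
      rw [← he] at h1 h2
      rw [hmass U hU, abs_le]
      omega
    have hzero : ∀ U : Set Ω, IsUpperSet U → mass U e = 0 → mass U d = 0 := fun U hU h => by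
      rw [hmass U hU, h, add_zero, sub_self]
    have hIcc : ∀ t ∈ d.support, u ≤ t ∧ t ≤ u' := by
      intro t ht
      rw [Finsupp.mem_support_iff] at ht
      by_contra hcon
      apply ht
      rw [← mass_Ici_sub_mass_Ioi, hzero _ (isUpperSet_Ici t), hzero _ (isUpperSet_Ioi t), sub_self]
      all_goals
        rw [he, map_sub, mass_single, mass_single]
        simp only [Set.mem_Ici, Set.mem_Ioi]
        rcases lt_or_ge t u with h1 | h1
        · simp [h1, h1.le, h1.le.trans h, h1.trans_le h]
        · have h2 : u' < t := not_le.1 fun h2 => hcon ⟨h1, h2⟩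
          simp [h2.not_ge, h2.le.not_gt, (h.trans_lt h2).not_ge, h1.not_gt]
    have key := norm_sum_smul_sub_le hpos ha hadd d.support (d := d) (fun T _ hup => by
      rw [sum_eq_mass_upperClosure d hup]
      exact habs _ (UpperSet.upper _)) (M := u') (fun x hx => (hIcc x hx).2) u
      fun x hx => (hIcc x hx).1
    rwa [← mass_univ, hzero _ isUpperSet_univ h0, zero_smul, sub_zero, ← pairing_eq_sum] at key
  · rw [sub_self, norm_zero]
    exact hpos _ _

end StepFunction

/-! ### Translations of bounded functions on a discrete group -/

section Translation

open BoundedContinuousFunction Filter Topology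

variable {G : Type u} [AddCommGroup G] [TopologicalSpace G] [DiscreteTopology G] {X : Type v}
  [NormedAddCommGroup X] {ι : Type*} [TopologicalSpace ι]

/-- Translation of a bounded function by a group element. -/
def translate (g : G) (f : G →ᵇ X) : G →ᵇ X :=
  f.compContinuous ⟨fun h => h + g, continuous_of_discreteTopology⟩

lemma translate_apply (g : G) (f : G →ᵇ X) (h : G) : translate g f h = f (h + g) := rfl

lemma translate_translate (g h : G) (f : G →ᵇ X) :
    translate g (translate h f) = translate (g + h) f := by
  ext k
  simp [translate_apply, add_assoc]

lemma translate_zero (f : G →ᵇ X) : translate 0 f = f := by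
  ext k
  simp [translate_apply]

lemma norm_translate (g : G) (f : G →ᵇ X) : ‖translate g f‖ = ‖f‖ := by
  have h : ∀ (g : G) (f : G →ᵇ X), ‖translate g f‖ ≤ ‖f‖ := fun g f =>
    (norm_le (norm_nonneg f)).2 fun k => f.norm_coe_le_norm _
  refine le_antisymm (h g f) ?_
  conv_lhs => rw [← translate_zero f, ← neg_add_cancel g, ← translate_translate]
  exact h _ _

lemma translate_sub (g : G) (f f' : G →ᵇ X) : translate g (f - f') = translate g f - translate g f' :=
  rfl

lemma isometry_translate (g : G) : Isometry (translate g : (G →ᵇ X) → G →ᵇ X) :=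
  Isometry.of_dist_eq fun f f' => by rw [dist_eq_norm, dist_eq_norm, ← translate_sub, norm_translate]

/-- The bounded functions whose translates along the family `κ` depend continuously on the
parameter. -/
def continuousTranslates (κ : ι → G) : Set (G →ᵇ X) :=
  {f | Continuous fun e => translate (κ e) f}

lemma isClosed_continuousTranslates (κ : ι → G) :
    IsClosed (continuousTranslates κ : Set (G →ᵇ X)) := by
  refine isClosed_of_closure_subset fun f hf => ?_
  refine continuous_of_uniform_approx_of_continuous fun u hu => ?_
  obtain ⟨ε, hε, hu⟩ := Metric.mem_uniformity_dist.1 hu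
  obtain ⟨f', hf', h⟩ := Metric.mem_closure_iff.1 hf ε hε
  refine ⟨_, hf', fun e => hu ?_⟩
  rwa [(isometry_translate (κ e)).dist_eq]

lemma translate_mem_continuousTranslates (κ : ι → G) (g : G) {f : G →ᵇ X}
    (hf : f ∈ continuousTranslates κ) : translate g f ∈ continuousTranslates κ := by
  have h : Continuous fun e => translate g (translate (κ e) f) :=
    (isometry_translate g).continuous.comp hf
  refine h.congr fun e => ?_
  rw [translate_translate, translate_translate, add_comm]

variable [NormedSpace ℂ X]

/-- `continuousTranslates` as a subspace. -/
def continuousTranslatesSubmodule (κ : ι → G) : Submodule ℂ (G →ᵇ X) where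
  carrier := continuousTranslates κ
  zero_mem' := (continuous_const (y := (0 : G →ᵇ X)) : Continuous fun _ : ι => (0 : G →ᵇ X))
  add_mem' hf hf' := Continuous.add hf hf'
  smul_mem' c _ hf := Continuous.const_smul hf c

/-- Translation as an isometric automorphism of the subspace. -/
def translateIsometryEquiv (κ : ι → G) (g : G) :
    continuousTranslatesSubmodule (X := X) κ ≃ₗᵢ[ℂ] continuousTranslatesSubmodule (X := X) κ where
  toFun f := ⟨translate g f, translate_mem_continuousTranslates κ g f.2⟩
  invFun f := ⟨translate (-g) f, translate_mem_continuousTranslates κ (-g) f.2⟩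
  left_inv f := Subtype.ext (by simp [translate_translate, translate_zero])
  right_inv f := Subtype.ext (by simp [translate_translate, translate_zero])
  map_add' _ _ := rfl
  map_smul' _ _ := rfl
  norm_map' f := norm_translate g f.1

/-- The map sending `x` to the function `g ↦ Φ g x`, for a family of contractions `Φ`. -/
noncomputable def orbitMap (Φ : G → X →L[ℂ] X) (hΦ : ∀ g, ‖Φ g‖ ≤ 1) : X →ₗ[ℂ] G →ᵇ X where
  toFun x := ofNormedAddCommGroupDiscrete (fun g => Φ g x) ‖x‖ fun g =>
    (Φ g).le_of_opNorm_le (hΦ g) x |>.trans_eq (one_mul _)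
  map_add' x y := by ext g; simp
  map_smul' c x := by ext g; simp

lemma norm_orbitMap {Φ : G → X →L[ℂ] X} (hΦ : ∀ g, ‖Φ g‖ ≤ 1) (h0 : Φ 0 = 1) (x : X) :
    ‖orbitMap Φ hΦ x‖ = ‖x‖ := by
  refine le_antisymm ((norm_le (norm_nonneg x)).2 fun g =>
    (Φ g).le_of_opNorm_le (hΦ g) x |>.trans_eq (one_mul _)) ?_
  have h : ‖Φ 0 x‖ ≤ ‖orbitMap Φ hΦ x‖ := (orbitMap Φ hΦ x).norm_coe_le_norm 0
  rwa [h0, one_apply_eq_self] at h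

lemma orbitMap_mem_continuousTranslates {Φ : G → X →L[ℂ] X} (hΦ : ∀ g, ‖Φ g‖ ≤ 1) {κ : ι → G}
    {δ : ι → ι → ℝ} (hδ : ∀ e₀, Tendsto (δ e₀) (𝓝 e₀) (𝓝 0))
    (hκ : ∀ e₀ e g, ‖Φ (g + κ e) - Φ (g + κ e₀)‖ ≤ δ e₀ e) (x : X) :
    orbitMap Φ hΦ x ∈ continuousTranslates κ := by
  refine continuous_iff_continuousAt.2 fun e₀ => ?_
  refine tendsto_iff_dist_tendsto_zero.2 ?_
  refine squeeze_zero (fun _ => dist_nonneg) (fun e => ?_)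
    (by simpa using (hδ e₀).mul_const ‖x‖)
  rw [dist_eq_norm]
  have hpos : 0 ≤ δ e₀ e := (norm_nonneg _).trans (hκ e₀ e 0)
  exact (norm_le (by positivity)).2 fun g =>
    (Φ (g + κ e) - Φ (g + κ e₀)).le_of_opNorm_le (hκ e₀ e g) x

end Translation

/-! ### Dilations from contractive extensions to a group -/

section Dilation

open BoundedContinuousFunction Filter Topology

variable {Ω : Type u} [TopologicalSpace Ω] {E : Set (Ω × Ω)} {G : Type u} [AddCommGroup G]

/-- If `φ = Φ ∘ κ`, where `κ` is an additive family in a commutative group and `Φ` is a family of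
contractions on the whole group with `Φ 0 = 1`, then translations on bounded functions on the group
dilate `φ`. No multiplicativity of `Φ` is needed. -/
theorem hasBanachDilation_of_extension {X : Type v} [NormedAddCommGroup X] [NormedSpace ℂ X]
    [CompleteSpace X] {κ : E → G} (hκ0 : ∀ (x : Ω) (hxx : (x, x) ∈ E), κ ⟨(x, x), hxx⟩ = 0)
    (hκ : IsAdditiveFamily κ) {Φ : G → X →L[ℂ] X} (hΦ : ∀ g, ‖Φ g‖ ≤ 1) (h0 : Φ 0 = 1)
    {δ : E → E → ℝ} (hδ : ∀ e₀, Tendsto (δ e₀) (𝓝 e₀) (𝓝 0))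
    (hδκ : ∀ e₀ e g, ‖Φ (g + κ e) - Φ (g + κ e₀)‖ ≤ δ e₀ e) :
    HasBanachDilation fun e => Φ (κ e) := by
  let _ : TopologicalSpace G := ⊥
  have : DiscreteTopology G := ⟨rfl⟩
  let Y : Submodule ℂ (G →ᵇ X) := continuousTranslatesSubmodule κ
  have hY : IsClosed (Y : Set (G →ᵇ X)) := isClosed_continuousTranslates κ
  let j : Y →L[ℂ] X := (evalCLM ℂ (0 : G)).comp Y.subtypeL
  let r : X →ₗᵢ[ℂ] Y :=
    { toLinearMap := (orbitMap Φ hΦ).codRestrict Y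
        (orbitMap_mem_continuousTranslates hΦ hδ hδκ)
      norm_map' := norm_orbitMap hΦ h0 }
  have hjr : ∀ x, j (r x) = x := fun x => by
    change Φ 0 x = x
    rw [h0, one_apply_eq_self]
  refine ⟨Y, inferInstance, inferInstance, hY.completeSpace_coe,
    fun e => translateIsometryEquiv κ (κ e), j, r, ⟨fun x hxx => ?_, fun x y z hxy hyz hxz => ?_⟩,
    fun f => ?_, fun x => ⟨r x, hjr x⟩, ?_, hjr, fun e x => ?_⟩
  · ext1 f
    refine Subtype.ext ?_
    change translate (κ _) f.1 = f.1
    rw [hκ0, translate_zero]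
  · ext1 f
    refine Subtype.ext ?_
    change translate (κ _) f.1 = translate (κ _) (translate (κ _) f.1)
    rw [translate_translate, hκ x y z hxy hyz hxz]
  · exact Continuous.subtype_mk f.2 _
  · refine j.opNorm_le_bound zero_le_one fun f => ?_
    rw [one_mul]
    exact f.1.norm_coe_le_norm 0
  · change Φ (0 + κ e) x = Φ (κ e) x
    rw [zero_add]

/-- The functions with continuous translates, as a C*-subalgebra. -/
def continuousTranslatesStarSubalgebra {ι : Type*} [TopologicalSpace ι] [TopologicalSpace G]
    [DiscreteTopology G] {𝔄 : Type v} [CStarAlgebra 𝔄] (κ : ι → G) :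
    StarSubalgebra ℂ (G →ᵇ 𝔄) where
  carrier := continuousTranslates κ
  add_mem' hf hf' := Continuous.add hf hf'
  mul_mem' hf hf' := Continuous.mul hf hf'
  algebraMap_mem' c :=
    (continuous_const (y := algebraMap ℂ (G →ᵇ 𝔄) c) :
      Continuous fun _ : ι => algebraMap ℂ (G →ᵇ 𝔄) c)
  star_mem' hf := Continuous.star hf

/-- Translation as a star automorphism of the C*-subalgebra. -/
noncomputable def translateStarAlgEquiv {ι : Type*} [TopologicalSpace ι] [TopologicalSpace G]
    [DiscreteTopology G] {𝔄 : Type v} [CStarAlgebra 𝔄] (κ : ι → G) (g : G) :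
    continuousTranslatesStarSubalgebra (𝔄 := 𝔄) κ ≃⋆ₐ[ℂ]
      continuousTranslatesStarSubalgebra (𝔄 := 𝔄) κ where
  toFun f := ⟨translate g f, translate_mem_continuousTranslates κ g f.2⟩
  invFun f := ⟨translate (-g) f, translate_mem_continuousTranslates κ (-g) f.2⟩
  left_inv f := Subtype.ext (by simp [translate_translate, translate_zero])
  right_inv f := Subtype.ext (by simp [translate_translate, translate_zero])
  map_add' _ _ := rfl
  map_mul' _ _ := rfl
  map_star' _ := rfl
  map_smul' _ _ := rfl

/-- The C*-algebraic version of `hasBanachDilation_of_extension`, for unital families `Φ` commuting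
with the involution. -/
theorem hasCStarDilation_of_extension {𝔄 : Type v} [CStarAlgebra 𝔄] [PartialOrder 𝔄]
    [StarOrderedRing 𝔄] {κ : E → G} (hκ0 : ∀ (x : Ω) (hxx : (x, x) ∈ E), κ ⟨(x, x), hxx⟩ = 0)
    (hκ : IsAdditiveFamily κ) {Φ : G → 𝔄 →L[ℂ] 𝔄} (hΦ : ∀ g, ‖Φ g‖ ≤ 1) (h0 : Φ 0 = 1)
    (hone : ∀ g, Φ g 1 = 1) (hstar : ∀ g a, Φ g (star a) = star (Φ g a))
    {δ : E → E → ℝ} (hδ : ∀ e₀, Tendsto (δ e₀) (𝓝 e₀) (𝓝 0))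
    (hδκ : ∀ e₀ e g, ‖Φ (g + κ e) - Φ (g + κ e₀)‖ ≤ δ e₀ e) :
    HasCStarDilation fun e => Φ (κ e) := by
  let _ : TopologicalSpace G := ⊥
  have : DiscreteTopology G := ⟨rfl⟩
  let S : StarSubalgebra ℂ (G →ᵇ 𝔄) := continuousTranslatesStarSubalgebra κ
  have hS : IsClosed (S : Set (G →ᵇ 𝔄)) := isClosed_continuousTranslates κ
  let _ : PartialOrder S := CStarAlgebra.spectralOrder S
  have : StarOrderedRing S := CStarAlgebra.spectralOrderedRing S
  let j : S →⋆ₐ[ℂ] 𝔄 :=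
    { toFun := fun f => f.1 0
      map_one' := rfl
      map_mul' := fun _ _ => rfl
      map_zero' := rfl
      map_add' := fun _ _ => rfl
      commutes' := fun _ => rfl
      map_star' := fun _ => rfl }
  let r₀ : 𝔄 →ₗ[ℂ] S :=
    { toFun := fun a => ⟨orbitMap Φ hΦ a, orbitMap_mem_continuousTranslates hΦ hδ hδκ a⟩
      map_add' := fun a b => Subtype.ext (map_add (orbitMap Φ hΦ) a b)
      map_smul' := fun c a => Subtype.ext (map_smul (orbitMap Φ hΦ) c a) }
  have hr1 : r₀ 1 = 1 := Subtype.ext (by ext g; exact hone g)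
  have hrn : ∀ a, ‖r₀ a‖ = ‖a‖ := norm_orbitMap hΦ h0
  have hrs : ∀ a, r₀ (star a) = star (r₀ a) := fun a => Subtype.ext (by ext g; exact hstar g a)
  -- A unital self-adjoint isometry is positive, since `x = x* ≥ 0` iff `‖‖x‖ - x‖ ≤ ‖x‖`.
  let r : 𝔄 →ₚ[ℂ] S := PositiveLinearMap.mk₀ r₀ fun a ha => by
    have hsa : IsSelfAdjoint (r₀ a) := by
      rw [IsSelfAdjoint, ← hrs, (IsSelfAdjoint.of_nonneg ha).star_eq]
    refine nonneg_of_norm_sub_le (M := ‖a‖) hsa ?_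
    have e : algebraMap ℝ S ‖a‖ - r₀ a = r₀ (algebraMap ℝ 𝔄 ‖a‖ - a) := by
      rw [map_sub, Algebra.algebraMap_eq_smul_one, Algebra.algebraMap_eq_smul_one,
        ← Complex.coe_smul, ← Complex.coe_smul, map_smul, hr1]
    rw [e, hrn]
    exact norm_algebraMap_sub_le ha
  have hjr : ∀ a, j (r a) = a := fun a => by
    change Φ 0 a = a
    rw [h0, one_apply_eq_self]
  refine ⟨S, inferInstance, inferInstance, inferInstance,
    fun e => translateStarAlgEquiv κ (κ e), j, r, fun hcomm f f' => ?_,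
    ⟨fun x hxx => ?_, fun x y z hxy hyz hxz => ?_⟩, fun f => ?_, fun a => ⟨r a, hjr a⟩, hrn, hr1,
    hjr, fun e a => ?_⟩
  · refine Subtype.ext ?_
    ext g
    exact hcomm _ _
  · ext1 f
    refine Subtype.ext ?_
    change translate (κ _) f.1 = f.1
    rw [hκ0, translate_zero]
  · ext1 f
    refine Subtype.ext ?_
    change translate (κ _) f.1 = translate (κ _) (translate (κ _) f.1)
    rw [translate_translate, hκ x y z hxy hyz hxz]
  · exact Continuous.subtype_mk f.2 _
  · change Φ (0 + κ e) a = Φ (κ e) a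
    rw [zero_add]

end Dilation

/-! ### Additive families on a linear order -/

section LinearOrder

open Filter Topology

variable {Ω : Type u} [LinearOrder Ω]

lemma IsAdditiveFamily.apply_self {V : Type*} [AddCommGroup V] {A : orderEdges Ω → V}
    (hA : IsAdditiveFamily A) (x : Ω) (hxx : (x, x) ∈ orderEdges Ω) : A ⟨(x, x), hxx⟩ = 0 := by
  simpa using hA x x x hxx hxx hxx

/-- An additive family consists of the increments of a function, namely of `v ↦ ± A(o, v)` for a base
point `o`. -/
lemma IsAdditiveFamily.exists_potential {V : Type*} [AddCommGroup V] {A : orderEdges Ω → V}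
    (hA : IsAdditiveFamily A) : ∃ a : Ω → V, ∀ e, A e = a e.1.2 - a e.1.1 := by
  rcases isEmpty_or_nonempty Ω with h | ⟨⟨o⟩⟩
  · exact ⟨fun _ => 0, fun e => h.elim e.1.1⟩
  refine ⟨fun t => if h : o ≤ t then A ⟨(o, t), h⟩ else -A ⟨(t, o), (not_le.1 h).le⟩, ?_⟩
  rintro ⟨⟨x, y⟩, hxy⟩
  change x ≤ y at hxy
  by_cases hx : o ≤ x
  · simp only [hx, hx.trans hxy, dif_pos]
    rw [hA o x y hx hxy (hx.trans hxy), add_sub_cancel_left]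
  · have hx' : x ≤ o := (not_le.1 hx).le
    by_cases hy : o ≤ y
    · simp only [hx, hy, dif_pos, dif_neg, not_false_eq_true, sub_neg_eq_add]
      rw [hA x o y hx' hy hxy, add_comm]
    · have hy' : y ≤ o := (not_le.1 hy).le
      simp only [hx, hy, dif_neg, not_false_eq_true, sub_neg_eq_add]
      rw [hA x y o hxy hy' hx']
      abel

/-- The formal interval `[u, v)` as an additive family. -/
noncomputable def intervalClass (e : orderEdges Ω) : Ω →₀ ℤ :=
  Finsupp.single e.1.2 1 - Finsupp.single e.1.1 1

lemma isAdditiveFamily_intervalClass : IsAdditiveFamily (intervalClass (Ω := Ω)) := by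
  intro x y z hxy hyz hxz
  simp [intervalClass]

/-- A length function on pairs in increasing order, as a symmetric function on all pairs. -/
def symmLength (ℓ : orderEdges Ω → ℝ≥0) (x y : Ω) : ℝ :=
  ℓ ⟨(min x y, max x y), min_le_max⟩

lemma symmLength_comm (ℓ : orderEdges Ω → ℝ≥0) (x y : Ω) :
    symmLength ℓ x y = symmLength ℓ y x := by
  simp only [symmLength, min_comm, max_comm]

lemma symmLength_of_le (ℓ : orderEdges Ω → ℝ≥0) {x y : Ω}
    (h : (x, y) ∈ orderEdges Ω) : symmLength ℓ x y = ℓ ⟨(x, y), h⟩ := by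
  have h' : x ≤ y := h
  simp only [symmLength, min_eq_left h', max_eq_right h']

variable [TopologicalSpace Ω]

lemma IsSuperadditiveLength.tendsto_symmLength [OrderClosedTopology Ω] {ℓ : orderEdges Ω → ℝ≥0}
    (hℓ : IsSuperadditiveLength ℓ) (x : Ω) : Tendsto (symmLength ℓ x) (𝓝 x) (𝓝 0) := by
  have hc : Continuous (symmLength ℓ x) := by
    unfold symmLength
    refine NNReal.continuous_coe.comp (hℓ.continuous.comp (Continuous.subtype_mk ?_ _))
    exact (continuous_const.min continuous_id).prodMk (continuous_const.max continuous_id)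
  have hxx : (x, x) ∈ orderEdges Ω := le_refl x
  have h := hc.tendsto x
  rwa [symmLength_of_le ℓ hxx, hℓ.self_eq_zero x hxx, NNReal.coe_zero] at h

/-- The estimate that makes the translations strongly continuous on the dilated vectors. -/
lemma norm_exp_stepGenerator_sub_le {X : Type v} [NormedAddCommGroup X] [NormedSpace ℂ X]
    [CompleteSpace X] {a : Ω → X →L[ℂ] X} {ℓ : orderEdges Ω → ℝ≥0} (hℓ : IsSuperadditiveLength ℓ)
    (ha : ∀ u v, (h : u ≤ v) → ‖a v - a u‖ ≤ ℓ ⟨(u, v), h⟩)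
    (hgen : ∀ g, IsContractionGenerator (stepGenerator a g)) (e₀ e : orderEdges Ω) (g : Ω →₀ ℤ) :
    ‖NormedSpace.exp (stepGenerator a (g + intervalClass e)) -
      NormedSpace.exp (stepGenerator a (g + intervalClass e₀))‖ ≤
      symmLength ℓ e₀.1.1 e.1.1 + symmLength ℓ e₀.1.2 e.1.2 := by
  refine ((hgen _).norm_exp_sub_exp_le (hgen _)).trans ?_
  have hle : ∀ g : Ω →₀ ℤ, ∀ u u' : Ω, u ≤ u' →
      ‖stepGenerator a (g + (Finsupp.single u' 1 - Finsupp.single u 1)) - stepGenerator a g‖ ≤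
        symmLength ℓ u u' := fun g u u' h =>
    norm_stepGenerator_add_sub_le (ℓ := symmLength ℓ) (fun _ _ => NNReal.coe_nonneg _)
      (fun u v h => by rw [symmLength_of_le ℓ h]; exact ha u v h)
      (fun u v w huv hvw => by
        rw [symmLength_of_le ℓ huv, symmLength_of_le ℓ hvw, symmLength_of_le ℓ (huv.trans hvw)]
        exact_mod_cast hℓ.superadditive u v w huv hvw (huv.trans hvw)) g h
  have hstep : ∀ g : Ω →₀ ℤ, ∀ u u' : Ω,
      ‖stepGenerator a (g + (Finsupp.single u' 1 - Finsupp.single u 1)) - stepGenerator a g‖ ≤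
        symmLength ℓ u u' := by
    intro g u u'
    rcases le_total u u' with h | h
    · exact hle g u u' h
    · have := hle (g + (Finsupp.single u' 1 - Finsupp.single u 1)) u' u h
      rw [add_assoc, sub_add_sub_cancel, sub_self, add_zero] at this
      rwa [norm_sub_rev, symmLength_comm]
  -- Move the left end point first, then the right one.
  set g₁ := g + intervalClass e₀ with hg₁
  set g₂ := g₁ + (Finsupp.single e₀.1.1 1 - Finsupp.single e.1.1 1) with hg₂
  have h1 := hstep g₁ e.1.1 e₀.1.1
  have h2 := hstep g₂ e₀.1.2 e.1.2
  have hg : g + intervalClass e = g₂ + (Finsupp.single e.1.2 1 - Finsupp.single e₀.1.2 1) := by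
    rw [hg₂, hg₁, intervalClass, intervalClass]
    abel
  rw [symmLength_comm] at h1
  rw [hg, ← sub_add_sub_cancel _ (stepGenerator a g₂)]
  linarith [norm_add_le (stepGenerator a (g₂ + (Finsupp.single e.1.2 1 - Finsupp.single e₀.1.2 1)) -
    stepGenerator a g₂) (stepGenerator a g₂ - stepGenerator a g₁)]

lemma IsSuperadditiveLength.tendsto_symmLength_add [OrderClosedTopology Ω]
    {ℓ : orderEdges Ω → ℝ≥0} (hℓ : IsSuperadditiveLength ℓ) (e₀ : orderEdges Ω) :
    Tendsto (fun e : orderEdges Ω => symmLength ℓ e₀.1.1 e.1.1 + symmLength ℓ e₀.1.2 e.1.2)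
      (𝓝 e₀) (𝓝 0) := by
  have h1 := (hℓ.tendsto_symmLength e₀.1.1).comp
    ((continuous_fst.comp continuous_subtype_val).tendsto e₀)
  have h2 := (hℓ.tendsto_symmLength e₀.1.2).comp
    ((continuous_snd.comp continuous_subtype_val).tendsto e₀)
  simpa [Function.comp_def] using h1.add h2

theorem hasBanachDilation_exp [OrderClosedTopology Ω] {X : Type v} [NormedAddCommGroup X]
    [NormedSpace ℂ X] [CompleteSpace X] {A : orderEdges Ω → X →L[ℂ] X} (hA : IsAdditiveFamily A)
    (hgrowth : HasGeometricGrowth A) (hgen : ∀ e, IsContractionGenerator (A e)) :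
    HasBanachDilation fun e => NormedSpace.exp (A e) := by
  obtain ⟨a, ha⟩ := hA.exists_potential
  obtain ⟨ℓ, hℓ, hAℓ⟩ := hgrowth
  let C : AddSubmonoid (X →L[ℂ] X) :=
    { carrier := {B | IsContractionGenerator B}
      zero_mem' := .zero
      add_mem' := .add }
  have hg : ∀ g, IsContractionGenerator (stepGenerator a g) :=
    stepGenerator_mem (C := C) fun u v h => by
      rw [← ha ⟨(u, v), h⟩]
      exact hgen _
  have h := hasBanachDilation_of_extension (Φ := fun g => NormedSpace.exp (stepGenerator a g))
    isAdditiveFamily_intervalClass.apply_self isAdditiveFamily_intervalClass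
    (fun g => (hg g).norm_exp_le_one) (by rw [stepGenerator_zero, NormedSpace.exp_zero])
    hℓ.tendsto_symmLength_add
    (norm_exp_stepGenerator_sub_le hℓ (fun u v h => by
      rw [← ha ⟨(u, v), h⟩]
      exact hAℓ _) hg)
  have e : A = fun e => stepGenerator a (intervalClass e) := funext fun e => by
    rw [intervalClass, stepGenerator_single_sub_single a e.2, ha]
  rw [e]
  exact h

lemma hasSum_exp_apply {X : Type v} [NormedAddCommGroup X] [NormedSpace ℂ X] [CompleteSpace X]
    (B : X →L[ℂ] X) (x : X) :
    HasSum (fun n : ℕ => ((n.factorial : ℂ)⁻¹) • (B ^ n) x) (NormedSpace.exp B x) := by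
  have h := NormedSpace.exp_series_hasSum_exp' (𝕂 := ℂ) B
  exact h.mapL (ContinuousLinearMap.apply ℂ X x)

lemma exp_apply_of_apply_eq_zero {X : Type v} [NormedAddCommGroup X] [NormedSpace ℂ X]
    [CompleteSpace X] {B : X →L[ℂ] X} {x : X} (h : B x = 0) : NormedSpace.exp B x = x := by
  refine (hasSum_exp_apply B x).unique ?_
  convert hasSum_single (f := fun n : ℕ => ((n.factorial : ℂ)⁻¹) • (B ^ n) x) 0 fun n hn => ?_
    using 1
  · simp
  · obtain ⟨m, rfl⟩ := Nat.exists_eq_succ_of_ne_zero hn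
    rw [pow_succ, mul_apply_eq_comp, h, map_zero, smul_zero]

lemma exp_apply_star {𝔄 : Type v} [CStarAlgebra 𝔄] {B : 𝔄 →L[ℂ] 𝔄}
    (h : ∀ a, B (star a) = star (B a)) (a : 𝔄) :
    NormedSpace.exp B (star a) = star (NormedSpace.exp B a) := by
  have hpow : ∀ n : ℕ, ∀ a, (B ^ n) (star a) = star ((B ^ n) a) := by
    intro n
    induction n with
    | zero => intro a; rfl
    | succ n ih => intro a; rw [pow_succ, mul_apply_eq_comp, mul_apply_eq_comp, h, ih]
  refine (hasSum_exp_apply B (star a)).unique ?_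
  convert (hasSum_exp_apply B a).star using 2 with n
  rw [hpow, star_smul]
  simp

theorem hasCStarDilation_exp [OrderClosedTopology Ω] {𝔄 : Type v} [CStarAlgebra 𝔄]
    [PartialOrder 𝔄] [StarOrderedRing 𝔄] {L : orderEdges Ω → 𝔄 →L[ℂ] 𝔄}
    (hL : IsAdditiveFamily L) (hgrowth : HasGeometricGrowth L)
    (hgen : ∀ e, IsContractionGenerator (L e)) (hone : ∀ e, L e 1 = 0)
    (hstar : ∀ e a, L e (star a) = star (L e a)) :
    HasCStarDilation fun e => NormedSpace.exp (L e) := by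
  obtain ⟨a, ha⟩ := hL.exists_potential
  obtain ⟨ℓ, hℓ, hLℓ⟩ := hgrowth
  let C : AddSubmonoid (𝔄 →L[ℂ] 𝔄) :=
    { carrier := {B | IsContractionGenerator B ∧ B 1 = 0 ∧ ∀ a, B (star a) = star (B a)}
      zero_mem' := ⟨.zero, rfl, fun a => by simp⟩
      add_mem' := fun hB hB' => ⟨hB.1.add hB'.1, by simp [hB.2.1, hB'.2.1],
        fun a => by simp [hB.2.2, hB'.2.2]⟩ }
  have hg : ∀ g, stepGenerator a g ∈ C :=
    stepGenerator_mem (C := C) fun u v h => by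
      rw [← ha ⟨(u, v), h⟩]
      exact ⟨hgen _, hone _, hstar _⟩
  have h := hasCStarDilation_of_extension (Φ := fun g => NormedSpace.exp (stepGenerator a g))
    isAdditiveFamily_intervalClass.apply_self isAdditiveFamily_intervalClass
    (fun g => (hg g).1.norm_exp_le_one) (by rw [stepGenerator_zero, NormedSpace.exp_zero])
    (fun g => exp_apply_of_apply_eq_zero (hg g).2.1) (fun g => exp_apply_star (hg g).2.2)
    hℓ.tendsto_symmLength_add
    (norm_exp_stepGenerator_sub_le hℓ (fun u v h => by
      rw [← ha ⟨(u, v), h⟩]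
      exact hLℓ _) fun g => (hg g).1)
  have e : L = fun e => stepGenerator a (intervalClass e) := funext fun e => by
    rw [intervalClass, stepGenerator_single_sub_single a e.2, ha]
  rw [e]
  exact h

end LinearOrder

end GraphDilation

theorem theorem3 {Ω : Type u} [LinearOrder Ω] [TopologicalSpace Ω] [OrderTopology Ω] :
    (∀ (X : Type v) [NormedAddCommGroup X] [NormedSpace ℂ X] [CompleteSpace X]
      (A : GraphDilation.orderEdges Ω → X →L[ℂ] X),
      Continuous A →
      GraphDilation.IsAdditiveFamily A →
      GraphDilation.HasGeometricGrowth A →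
      (∀ e, GraphDilation.IsDissipative (A e)) →
      GraphDilation.HasBanachDilation fun e => NormedSpace.exp (A e)) ∧
    (∀ (𝔄 : Type v) [CStarAlgebra 𝔄] [PartialOrder 𝔄] [StarOrderedRing 𝔄]
      (L : GraphDilation.orderEdges Ω → 𝔄 →L[ℂ] 𝔄),
      Continuous L →
      GraphDilation.IsAdditiveFamily L →
      GraphDilation.HasGeometricGrowth L →
      (∀ e, GraphDilation.IsSelfAdjointMap (L e)) →
      (∀ e, L e 1 = 0) →
      (∀ e a, 0 ≤ GraphDilation.dissipationMap (L e) a a) →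
      GraphDilation.HasCStarDilation fun e => NormedSpace.exp (L e)) := by
  refine ⟨fun X _ _ _ A _ hA hgrowth hdiss => ?_, fun 𝔄 _ _ _ L _ hL hgrowth hsa hone hD => ?_⟩
  · exact GraphDilation.hasBanachDilation_exp hA hgrowth fun e => (hdiss e).isContractionGenerator
  · exact GraphDilation.hasCStarDilation_exp hL hgrowth
      (fun e => GraphDilation.isContractionGenerator_of_dissipationMap_nonneg (hsa e) (hone e) (hD e))
      hone fun e => (hsa e).map_star
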